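/- Work over $\mathbb{C}$. Let $\mathbf{V}=\mathbb{C}^{\infty|\infty}$ be the super vector space with even basis $e_1,e_2,\dots$ and odd basis $f_1,f_2,\dots$, and write $(-)[1]$ for the shift of the super grading. Let $\mathcal{V}$ be the category of polynomial representations of $\mathbf{GL}_{\infty|\infty}=\bigcup_n \mathbf{GL}_{n|n}$ (equivalently, of its Lie superalgebra $\mathfrak{gl}_{\infty|\infty}$), that is, of those representations on super vector spaces that are isomorphic to a (possibly infinite) direct sum of representations of the form $\mathbf{S}_\lambda(\mathbf{V})$ and $\mathbf{S}_\lambda(\mathbf{V})[1]$, where $\mathbf{S}_\lambda$ is the Schur functor of the partition $\lambda$; morphisms are the equivariant linear maps of super degree $0$. For a super vector space $U$, let $\mathrm{Sym}(U)$ and $\bigwedge(U)$ be the quotients of the tensor algebra of $U$ by the relations $uw=(-1)^{|u||w|}wu$, respectively $uw=-(-1)^{|u||w|}wu$, for homogeneous $u,w\in U$, and let $\mathrm{Sym}^2(U)$ be the degree two part of $\mathrm{Sym}(U)$. Put $$A=\mathrm{Sym}(\mathrm{Sym}^2(\mathbf{V})[1]),\qquad A'=\bigwedge(\mathrm{Sym}^2(\mathbf{V})),$$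 regarded as algebras in $\mathcal{V}$. For $B\in\{A,A'\}$, let $\mathrm{Mod}_B$ be the category of left $B$-modules in $\mathcal{V}$, that is, of polynomial representations $M$ with a $B$-module structure whose multiplication map $B\otimes M\to M$ is a morphism of representations of super degree $0$; its morphisms are the $B$-linear morphisms of $\mathcal{V}$. A submodule of $M$ is a $B$-submodule that is also a subrepresentation (homogeneous for the super grading). A $B$-module is finitely generated if it is the smallest submodule of itself containing some finite set of its elements, and $B$ is noetherian if every submodule of every finitely generated $B$-module is finitely generated. **Proposition.** The categories $\mathrm{Mod}_A$ and $\mathrm{Mod}_{A'}$ are equivalent, by a $\mathbb{C}$-linear equivalence. In particular, $A$ is noetherian if and only if $A'$ is noetherian. -/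

import Mathlib

universe u v

noncomputable section

namespace SuperTCA

open scoped DirectSum

/-! ### Super conventions

The base field is `ℂ`. A super vector space is a `ℂ`-module with an involution `parity`
acting by `(-1) ^ p` on the part of super degree `p`. -/

/-- The index set of the homogeneous basis of `𝕍 = ℂ^{∞|∞}`:
`inl i` stands for the even vector `e_i` and `inr i` for the odd vector `f_i`. -/
abbrev Idx : Type := ℕ ⊕ ℕ

/-- The super degree of a basis vector of `𝕍`. -/
def par : Idx → ZMod 2
  | Sum.inl _ => 0
  | Sum.inr _ => 1

/-- The sign `(-1) ^ p`. -/
def sgn (p : ZMod 2) : ℂ := if p = 0 then 1 else -1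

theorem zmod2_cases (p : ZMod 2) : p = 0 ∨ p = 1 := by
  revert p; decide

@[simp] theorem sgn_zero : sgn 0 = 1 := by simp [sgn]

@[simp] theorem sgn_one : sgn 1 = -1 := by simp [sgn]

theorem sgn_add (p q : ZMod 2) : sgn (p + q) = sgn p * sgn q := by
  have h : (1 : ZMod 2) + 1 = 0 := by decide
  rcases zmod2_cases p with rfl | rfl <;> rcases zmod2_cases q with rfl | rfl <;> simp [h]

@[simp] theorem sgn_mul_self (p : ZMod 2) : sgn p * sgn p = 1 := by
  rcases zmod2_cases p with rfl | rfl <;> simp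

theorem add_self (p : ZMod 2) : p + p = 0 := by
  revert p; decide

/-- A representation of the Lie superalgebra `𝔤𝔩_{∞|∞}` on the super vector space `M`.
The Lie superalgebra of finitely supported matrices has the matrix units `E_{ab}` as a basis;
`E_{ab}` has super degree `par a + par b`, and `act a b` is the operator by which it acts.

As the base field has characteristic zero and the group is connected, polynomial
representations of the supergroup `GL_{∞|∞}`, their equivariant maps, tensor products and
subrepresentations are the same as those of its Lie superalgebra (see `IsPolynomial`). -/
class SuperRep (M : Type u) [AddCommGroup M] [Module ℂ M] where
  /-- `(-1) ^ p` on the part of super degree `p`. -/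
  parity : Module.End ℂ M
  /-- The action of the matrix unit `E_{ab}`. -/
  act : Idx → Idx → Module.End ℂ M
  parity_parity : ∀ m, parity (parity m) = m
  parity_act : ∀ a b m, parity (act a b m) = sgn (par a + par b) • act a b (parity m)
  /-- The super commutator relation
  `[E_{ab}, E_{cd}] = δ_{bc} E_{ad} - (-1) ^ (|E_{ab}| |E_{cd}|) δ_{da} E_{cb}`. -/
  bracket : ∀ a b c d m,
    act a b (act c d m) - sgn ((par a + par b) * (par c + par d)) • act c d (act a b m) =
      (if b = c then act a d m else 0) -
        sgn ((par a + par b) * (par c + par d)) • (if d = a then act c b m else 0)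

open SuperRep

section General

variable {M : Type u} [AddCommGroup M] [Module ℂ M] [SuperRep M]

variable (M) in
/-- The `p`-th power of the parity operator, for `p : ZMod 2`. -/
def parityPow (p : ZMod 2) : Module.End ℂ M := if p = 0 then 1 else parity

theorem parityPow_zero (m : M) : parityPow M 0 m = m := by simp [parityPow]

theorem parityPow_one (m : M) : parityPow M 1 m = parity m := by simp [parityPow]

/-- `m` is homogeneous of super degree `p`. -/
def IsHomog (p : ZMod 2) (m : M) : Prop := parity m = sgn p • m

theorem IsHomog.parityPow {p : ZMod 2} {m : M} (h : IsHomog p m) (q : ZMod 2) :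
    parityPow M q m = sgn (q * p) • m := by
  rcases zmod2_cases q with rfl | rfl
  · simp [parityPow_zero]
  · rw [parityPow_one, one_mul]; exact h

theorem IsHomog.act {p : ZMod 2} {m : M} (h : IsHomog p m) (a b : Idx) :
    IsHomog (par a + par b + p) (act a b m) := by
  unfold IsHomog at *
  rw [parity_act, h, map_smul, smul_smul, sgn_add _ p]

theorem parityPow_act (p : ZMod 2) (a b : Idx) (m : M) :
    parityPow M p (act a b m) = sgn (p * (par a + par b)) • act a b (parityPow M p m) := by
  rcases zmod2_cases p with rfl | rfl
  · simp [parityPow_zero]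
  · simp [parityPow_one, parity_act]

theorem parityPow_add (p q : ZMod 2) (m : M) :
    parityPow M (p + q) m = parityPow M p (parityPow M q m) := by
  have h : (1 : ZMod 2) + 1 = 0 := by decide
  rcases zmod2_cases p with rfl | rfl <;> rcases zmod2_cases q with rfl | rfl <;>
    simp [h, parityPow_zero, parityPow_one, parity_parity]

/-- A linear subspace that is a subrepresentation: a super subspace (the span of its
homogeneous elements) stable under `𝔤𝔩_{∞|∞}`. -/
structure IsStable (N : Submodule ℂ M) : Prop where
  parity_mem : ∀ m ∈ N, parity m ∈ N
  act_mem : ∀ a b, ∀ m ∈ N, act a b m ∈ N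

/-- A subrepresentation is a representation. -/
abbrev IsStable.superRep {N : Submodule ℂ M} (h : IsStable N) : SuperRep N where
  parity := parity.restrict h.parity_mem
  act a b := (act a b).restrict (h.act_mem a b)
  parity_parity m := Subtype.ext (parity_parity (m : M))
  parity_act a b m := Subtype.ext (parity_act a b (m : M))
  bracket a b c d m := by
    apply Subtype.ext
    have := bracket a b c d (m : M)
    split_ifs at this ⊢ <;> simpa using this

end General

/-- An isomorphism of representations (of super degree zero). -/
structure RepEquiv (M : Type u) (N : Type v) [AddCommGroup M] [Module ℂ M] [SuperRep M]
    [AddCommGroup N] [Module ℂ N] [SuperRep N] extends M ≃ₗ[ℂ] N where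
  map_parity : ∀ m, toFun (parity m) = parity (toFun m)
  map_act : ∀ a b m, toFun (act a b m) = act a b (toFun m)

/-! ### Parity shifts and direct sums -/

/-- The shift `M[p]`, i.e. `M ⊗ ℂ[p]` with the one-dimensional trivial representation `ℂ[p]`
of super degree `p` as the right factor: the super grading is shifted by `p`, the
operators by which `𝔤𝔩_{∞|∞}` acts are unchanged. -/
@[nolint unusedArguments]
def Shift (_p : ZMod 2) (M : Type u) : Type u := M

section Shift

variable (p : ZMod 2) (M : Type u) [AddCommGroup M] [Module ℂ M]

instance : AddCommGroup (Shift p M) := inferInstanceAs (AddCommGroup M)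

instance : Module ℂ (Shift p M) := inferInstanceAs (Module ℂ M)

variable {M} in
theorem shift_parity_aux [SuperRep M] (m : M) :
    (sgn p • parity : Module.End ℂ M) ((sgn p • parity : Module.End ℂ M) m) = m := by
  rw [LinearMap.smul_apply, LinearMap.smul_apply, map_smul, smul_smul, sgn_mul_self, one_smul,
    parity_parity]

variable {M} in
theorem shift_act_aux [SuperRep M] (a b : Idx) (m : M) :
    (sgn p • parity : Module.End ℂ M) (act a b m) =
      sgn (par a + par b) • act a b ((sgn p • parity : Module.End ℂ M) m) := by
  rw [LinearMap.smul_apply, LinearMap.smul_apply, map_smul, parity_act, smul_comm]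

instance [SuperRep M] : SuperRep (Shift p M) where
  parity := (sgn p • parity : Module.End ℂ M)
  act a b := (act a b : Module.End ℂ M)
  parity_parity := shift_parity_aux (M := M) p
  parity_act := shift_act_aux (M := M) p
  bracket := bracket (M := M)

end Shift

instance {I : Type v} (M : I → Type u) [∀ i, AddCommGroup (M i)] [∀ i, Module ℂ (M i)]
    [∀ i, SuperRep (M i)] : SuperRep (⨁ i, M i) where
  parity := DirectSum.lmap fun _ => parity
  act a b := DirectSum.lmap fun _ => act a b
  parity_parity m := by
    refine DFinsupp.ext fun i => ?_
    exact parity_parity (m i)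
  parity_act a b m := by
    refine DFinsupp.ext fun i => ?_
    exact parity_act a b (m i)
  bracket a b c d m := by
    refine DFinsupp.ext fun i => ?_
    have := bracket a b c d (m i)
    split_ifs at this ⊢ <;> exact this

/-! ### Tensor powers of `𝕍` and Schur functors -/

/-- The tensor power `𝕍^{⊗ n}`, with its basis `v_{w 0} ⊗ ⋯ ⊗ v_{w (n - 1)}` indexed by the words
`w` of length `n` in the basis of `𝕍`. -/
abbrev TPow (n : ℕ) : Type := (Fin n → Idx) →₀ ℂ

/-- The total super degree of the factors of a word that stand before position `k`. -/
def parBefore {n : ℕ} (w : Fin n → Idx) (k : Fin n) : ZMod 2 :=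
  ∑ l ∈ Finset.univ.filter (· < k), par (w l)

/-- The matrix unit `E_{ab}` acting on the `k`-th tensor factor, with the sign
produced by moving it past the factors before the `k`-th. -/
def posAct {n : ℕ} (k : Fin n) (a b : Idx) : Module.End ℂ (TPow n) :=
  Finsupp.linearCombination ℂ fun w =>
    if w k = b then
      sgn ((par a + par b) * parBefore w k) • Finsupp.single (Function.update w k a) (1 : ℂ)
    else 0

/-- The parity operator of `𝕍^{⊗ n}`. -/
def tpowParity (n : ℕ) : Module.End ℂ (TPow n) :=
  Finsupp.linearCombination ℂ fun w => sgn (∑ l, par (w l)) • Finsupp.single w (1 : ℂ)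

theorem posAct_single {n : ℕ} (k : Fin n) (a b : Idx) (w : Fin n → Idx) :
    posAct k a b (Finsupp.single w 1) =
      if w k = b then
        sgn ((par a + par b) * parBefore w k) • Finsupp.single (Function.update w k a) (1 : ℂ)
      else 0 := by
  simp [posAct]

theorem tpowParity_single {n : ℕ} (w : Fin n → Idx) :
    tpowParity n (Finsupp.single w 1) = sgn (∑ l, par (w l)) • Finsupp.single w (1 : ℂ) := by
  simp [tpowParity]

theorem tpow_ext {n : ℕ} {f g : Module.End ℂ (TPow n)}
    (h : ∀ w, f (Finsupp.single w 1) = g (Finsupp.single w 1)) : f = g := by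
  refine Finsupp.lhom_ext' fun w => LinearMap.ext_ring ?_
  exact h w

theorem par_update {n : ℕ} (w : Fin n → Idx) (k : Fin n) (a : Idx) (l : Fin n) :
    par (Function.update w k a l) = par (w l) + if l = k then par a + par (w k) else 0 := by
  by_cases h : l = k
  · subst h
    have := add_self (par (w l))
    simp only [Function.update_self, if_true]
    linear_combination -this
  · simp [h]

theorem parBefore_update {n : ℕ} (w : Fin n → Idx) (k : Fin n) (a : Idx) (l : Fin n) :
    parBefore (Function.update w k a) l =
      parBefore w l + if k < l then par a + par (w k) else 0 := by
  unfold parBefore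
  simp_rw [par_update, Finset.sum_add_distrib]
  congr 1
  simp [Finset.sum_ite_eq']

theorem tpow_parity_posAct {n : ℕ} (k : Fin n) (a b : Idx) (m : TPow n) :
    tpowParity n (posAct k a b m) = sgn (par a + par b) • posAct k a b (tpowParity n m) := by
  suffices h : tpowParity n ∘ₗ posAct k a b =
      sgn (par a + par b) • (posAct k a b ∘ₗ tpowParity n) from LinearMap.congr_fun h m
  refine tpow_ext fun w => ?_
  simp only [LinearMap.comp_apply, LinearMap.smul_apply, posAct_single, tpowParity_single,
    map_smul]
  split_ifs with h
  · subst h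
    rw [map_smul, tpowParity_single]
    simp_rw [par_update, Finset.sum_add_distrib, sgn_add]
    simp only [Finset.sum_ite_eq', Finset.mem_univ, if_true, smul_smul, sgn_add]
    congr 1; ring
  · simp

theorem posAct_same {n : ℕ} (k : Fin n) (a b c d : Idx) (m : TPow n) :
    posAct k a b (posAct k c d m) = if b = c then posAct k a d m else 0 := by
  suffices h : posAct k a b ∘ₗ posAct k c d = if b = c then posAct k a d else 0 by
    have := LinearMap.congr_fun h m
    split_ifs at this ⊢ <;> exact this
  refine tpow_ext fun w => ?_
  rw [LinearMap.comp_apply, posAct_single]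
  by_cases hd : w k = d
  · rw [if_pos hd, map_smul, posAct_single]
    by_cases hb : b = c
    · subst hb
      rw [if_pos (by simp), if_pos rfl, posAct_single, if_pos hd, smul_smul, parBefore_update]
      simp only [lt_irrefl, if_false, add_zero, Function.update_idem, ← sgn_add]
      congr 2
      linear_combination (parBefore w k) * add_self (par b)
    · rw [if_neg (by simpa using Ne.symm hb), if_neg hb]; simp
  · rw [if_neg hd]
    split_ifs
    · rw [posAct_single, if_neg hd, map_zero]
    · simp

theorem posAct_lt {n : ℕ} {k l : Fin n} (hkl : k < l) (a b c d : Idx) (m : TPow n) :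
    posAct k a b (posAct l c d m) =
      sgn ((par a + par b) * (par c + par d)) • posAct l c d (posAct k a b m) := by
  suffices h : posAct k a b ∘ₗ posAct l c d =
      sgn ((par a + par b) * (par c + par d)) • (posAct l c d ∘ₗ posAct k a b) from
    LinearMap.congr_fun h m
  refine tpow_ext fun w => ?_
  simp only [LinearMap.comp_apply, LinearMap.smul_apply, posAct_single]
  by_cases hb : w k = b
  · by_cases hd : w l = d
    · subst hb hd
      simp only [if_true, map_smul, posAct_single, Function.update_of_ne hkl.ne,
        Function.update_of_ne hkl.ne', parBefore_update, if_pos hkl, if_neg hkl.le.not_gt,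
        add_zero, smul_smul, ← sgn_add, Function.update_comm hkl.ne]
      congr 2
      linear_combination
        -(par a + par (w k)) * (par c + par (w l)) * add_self 1
    · rw [if_pos hb, if_neg hd, map_zero, map_smul, posAct_single,
        if_neg (by rwa [Function.update_of_ne hkl.ne']), smul_zero, smul_zero]
  · by_cases hd : w l = d
    · rw [if_neg hb, if_pos hd, map_zero, map_smul, posAct_single,
        if_neg (by rwa [Function.update_of_ne hkl.ne]), smul_zero, smul_zero]
    · simp [hb, hd]

theorem posAct_ne {n : ℕ} {k l : Fin n} (hkl : k ≠ l) (a b c d : Idx) (m : TPow n) :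
    posAct k a b (posAct l c d m) =
      sgn ((par a + par b) * (par c + par d)) • posAct l c d (posAct k a b m) := by
  rcases lt_or_gt_of_ne hkl with h | h
  · exact posAct_lt h a b c d m
  · rw [posAct_lt h, smul_smul, mul_comm (par c + par d), sgn_mul_self, one_smul]

instance (n : ℕ) : SuperRep (TPow n) where
  parity := tpowParity n
  act a b := ∑ k, posAct k a b
  parity_parity m := by
    suffices h : tpowParity n ∘ₗ tpowParity n = 1 from LinearMap.congr_fun h m
    refine tpow_ext fun w => ?_
    rw [LinearMap.comp_apply, tpowParity_single, map_smul, tpowParity_single, smul_smul,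
      sgn_mul_self, one_smul, Module.End.one_apply]
  parity_act a b m := by
    simp only [LinearMap.sum_apply, map_sum, Finset.smul_sum, tpow_parity_posAct]
  bracket a b c d m := by
    simp only [LinearMap.sum_apply, map_sum, Finset.smul_sum]
    rw [Finset.sum_comm]
    rw [← Finset.sum_sub_distrib]
    have key : ∀ k : Fin n,
        (∑ l, posAct k a b (posAct l c d m)) -
          ∑ l, sgn ((par a + par b) * (par c + par d)) • posAct l c d (posAct k a b m) =
        (if b = c then posAct k a d m else 0) -
          sgn ((par a + par b) * (par c + par d)) • if d = a then posAct k c b m else 0 := by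
      intro k
      rw [← Finset.sum_sub_distrib, Finset.sum_eq_single k]
      · rw [posAct_same, posAct_same]
      · intro l _ hl
        rw [posAct_ne hl.symm, sub_self]
      · simp
    rw [Finset.sum_congr rfl fun k _ => key k, Finset.sum_sub_distrib, ← Finset.smul_sum]
    split_ifs <;> simp

/-- The exponent of the Koszul sign picked up when the factors of the word `w` are permuted
by `π`: each inversion of `π` contributes the product of the super degrees of its factors. -/
def invParity {n : ℕ} (π : Equiv.Perm (Fin n)) (w : Fin n → Idx) : ZMod 2 :=
  ∑ i, ∑ j, if i < j ∧ π j < π i then par (w i) * par (w j) else 0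

/-- The action of a permutation on `𝕍^{⊗ n}` through the symmetry of super vector spaces: the
factor in position `i` moves to position `π i`, with the Koszul sign. -/
def permAct {n : ℕ} (π : Equiv.Perm (Fin n)) : Module.End ℂ (TPow n) :=
  Finsupp.linearCombination ℂ fun w =>
    sgn (invParity π w) • Finsupp.single (w ∘ π.symm) (1 : ℂ)

theorem permAct_single {n : ℕ} (π : Equiv.Perm (Fin n)) (w : Fin n → Idx) :
    permAct π (Finsupp.single w 1) =
      sgn (invParity π w) • Finsupp.single (w ∘ π.symm) (1 : ℂ) := by
  simp [permAct]

theorem invParity_update {n : ℕ} (π : Equiv.Perm (Fin n)) (w : Fin n → Idx) (k : Fin n)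
    (a : Idx) :
    (par a + par (w k)) * parBefore (w ∘ π.symm) (π k) + invParity π w =
      (par a + par (w k)) * parBefore w k + invParity π (Function.update w k a) := by
  set p := par a + par (w k) with hp
  have h1 : parBefore (w ∘ π.symm) (π k) = ∑ l, if π l < π k then par (w l) else 0 := by
    unfold parBefore
    rw [Finset.sum_filter, ← Equiv.sum_comp π]
    simp
  have h2 : invParity π (Function.update w k a) = invParity π w +
      ((∑ j, if k < j ∧ π j < π k then p * par (w j) else 0) +
        ∑ i, if i < k ∧ π k < π i then p * par (w i) else 0) := by
    have e : ∀ i j, (if i < j ∧ π j < π i then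
          par (Function.update w k a i) * par (Function.update w k a j) else 0) =
        (if i < j ∧ π j < π i then par (w i) * par (w j) else 0) +
        ((if i = k then (if i < j ∧ π j < π i then p * par (w j) else 0) else 0) +
        (if j = k then (if i < j ∧ π j < π i then p * par (w i) else 0) else 0)) := by
      intro i j
      rw [par_update, par_update, ← hp]
      by_cases hi : i = k
      · subst hi
        by_cases hj : j = i
        · simp [hj]
        · simp only [hj, if_true, if_false]
          split_ifs <;> ring
      · by_cases hj : j = k
        · simp only [hi, hj, if_true, if_false]
          split_ifs <;> ring
        · simp [hi, hj]
    unfold invParity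
    simp_rw [e, Finset.sum_add_distrib]
    congr 2
    · rw [Finset.sum_eq_single k]
      · simp
      · intro b _ hb; simp [hb]
      · simp
    · simp
  have h3 : p * parBefore (w ∘ π.symm) (π k) = p * parBefore w k +
      ((∑ j, if k < j ∧ π j < π k then p * par (w j) else 0) +
        ∑ i, if i < k ∧ π k < π i then p * par (w i) else 0) := by
    rw [h1, parBefore, Finset.sum_filter, Finset.mul_sum, Finset.mul_sum,
      ← Finset.sum_add_distrib, ← Finset.sum_add_distrib]
    refine Finset.sum_congr rfl fun l _ => ?_
    have z := add_self (p * par (w l))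
    rcases lt_trichotomy l k with hl | hl | hl
    · rcases lt_or_gt_of_ne (π.injective.ne hl.ne) with h | h
      · simp [hl, h, hl.not_gt, h.not_gt]
      · simp [hl, h, hl.not_gt, h.not_gt, z]
    · subst hl; simp
    · simp [hl, hl.not_gt]
  rw [h2, h3]; ring

theorem posAct_permAct {n : ℕ} (π : Equiv.Perm (Fin n)) (k : Fin n) (a b : Idx) :
    posAct (π k) a b * permAct π = permAct π * posAct k a b := by
  refine tpow_ext fun w => ?_
  rw [Module.End.mul_apply, Module.End.mul_apply, permAct_single, posAct_single, map_smul,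
    posAct_single]
  have hk : (w ∘ π.symm) (π k) = w k := by simp
  rw [hk]
  split_ifs with h
  · subst h
    rw [map_smul, permAct_single, smul_smul, smul_smul, ← sgn_add, ← sgn_add]
    have hu : Function.update (w ∘ π.symm) (π k) a = Function.update w k a ∘ π.symm := by
      rw [Function.update_comp_equiv]; simp
    rw [hu, ← invParity_update, add_comm]
  · simp

theorem act_permAct {n : ℕ} (π : Equiv.Perm (Fin n)) (a b : Idx) (m : TPow n) :
    act a b (permAct π m) = permAct π (act a b m) := by
  change (∑ k, posAct k a b) (permAct π m) = permAct π ((∑ k, posAct k a b) m)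
  rw [LinearMap.sum_apply, LinearMap.sum_apply, map_sum, ← Equiv.sum_comp π]
  exact Finset.sum_congr rfl fun k _ => LinearMap.congr_fun (posAct_permAct π k a b) m

theorem parity_permAct {n : ℕ} (π : Equiv.Perm (Fin n)) (m : TPow n) :
    parity (permAct π m) = permAct π (parity m) := by
  change tpowParity n (permAct π m) = permAct π (tpowParity n m)
  suffices h : tpowParity n * permAct π = permAct π * tpowParity n from LinearMap.congr_fun h m
  refine tpow_ext fun w => ?_
  rw [Module.End.mul_apply, Module.End.mul_apply, permAct_single, tpowParity_single, map_smul,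
    map_smul, permAct_single, tpowParity_single, smul_comm]
  congr 2
  rw [← Equiv.sum_comp π]
  simp

open Classical in
/-- The Young symmetrizer of the Young diagram `μ` acting on `𝕍^{⊗ |μ|}`: for a bijective
filling `T` of the cells of `μ` by the tensor positions, it is
`(∑_p p) (∑_q sign(q) q)` with `p` running over the permutations preserving the rows
of `T` and `q` over those preserving its columns. (Another filling
gives a conjugate symmetrizer.) -/
def youngSymmetrizer (μ : YoungDiagram) : Module.End ℂ (TPow μ.card) :=
  let T : Fin μ.card → ℕ × ℕ := fun k => (μ.cells.equivFin.symm k : ℕ × ℕ)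
  (∑ p : Equiv.Perm (Fin μ.card), if ∀ k, (T (p k)).1 = (T k).1 then permAct p else 0) *
    ∑ q : Equiv.Perm (Fin μ.card),
      if ∀ k, (T (q k)).2 = (T k).2 then ((Equiv.Perm.sign q : ℤ) : ℂ) • permAct q else 0

theorem youngSymmetrizer_comm (μ : YoungDiagram) (f : Module.End ℂ (TPow μ.card))
    (h : ∀ π, Commute f (permAct π)) : Commute f (youngSymmetrizer μ) := by
  classical
  refine Commute.mul_right (Commute.sum_right _ _ _ fun p _ => ?_)
    (Commute.sum_right _ _ _ fun p _ => ?_)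
  · split_ifs
    · exact h p
    · exact Commute.zero_right _
  · split_ifs
    · exact (h p).smul_right _
    · exact Commute.zero_right _

/-- The Schur functor `𝐒_μ(𝕍)`, the image of the Young symmetrizer on `𝕍^{⊗ |μ|}`. -/
def Schur (μ : YoungDiagram) : Submodule ℂ (TPow μ.card) :=
  LinearMap.range (youngSymmetrizer μ)

theorem schur_isStable (μ : YoungDiagram) : IsStable (Schur μ) where
  parity_mem := by
    rintro _ ⟨m, rfl⟩
    exact ⟨parity m, (LinearMap.congr_fun (youngSymmetrizer_comm μ parity fun π =>
      LinearMap.ext fun x => parity_permAct π x).eq m).symm⟩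
  act_mem := by
    rintro a b _ ⟨m, rfl⟩
    exact ⟨act a b m, (LinearMap.congr_fun (youngSymmetrizer_comm μ (act a b) fun π =>
      LinearMap.ext fun x => act_permAct π a b x).eq m).symm⟩

instance (μ : YoungDiagram) : SuperRep (Schur μ) := (schur_isStable μ).superRep

/-- A polynomial representation of `GL_{∞|∞}`: one that is isomorphic to a (possibly infinite)
direct sum of representations of the form `𝐒_λ(𝕍)` and `𝐒_λ(𝕍)[1]`. -/
def IsPolynomial (M : Type u) [AddCommGroup M] [Module ℂ M] [SuperRep M] : Prop :=
  ∃ (I : Type u) (lam : I → YoungDiagram) (p : I → ZMod 2),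
    Nonempty (RepEquiv M (⨁ i, Shift (p i) (Schur (lam i))))

/-! ### Super symmetric and exterior algebras -/

/-- The relations `u w = ε (-1) ^ (|u| |w|) w u` for homogeneous `u` and `w` in the
tensor algebra. -/
inductive QuadRel (ε : ℂ) (U : Type u) [AddCommGroup U] [Module ℂ U] [SuperRep U] :
    TensorAlgebra ℂ U → TensorAlgebra ℂ U → Prop
  | swap (p q : ZMod 2) (u w : U) (hu : IsHomog p u) (hw : IsHomog q w) :
      QuadRel ε U (TensorAlgebra.ι ℂ u * TensorAlgebra.ι ℂ w)
        ((ε * sgn (p * q)) • (TensorAlgebra.ι ℂ w * TensorAlgebra.ι ℂ u))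

/-- The quotient of the tensor algebra of `U` by the relations
`u w = ε (-1) ^ (|u| |w|) w u` for homogeneous `u` and `w`. -/
def QuadAlg (ε : ℂ) (U : Type u) [AddCommGroup U] [Module ℂ U] [SuperRep U] : Type u :=
  RingQuot (QuadRel ε U)

/-- The symmetric algebra `Sym(U)` of a super vector space. -/
abbrev SymAlg (U : Type u) [AddCommGroup U] [Module ℂ U] [SuperRep U] : Type u := QuadAlg 1 U

/-- The exterior algebra `⋀(U)` of a super vector space. -/
abbrev ExtAlg (U : Type u) [AddCommGroup U] [Module ℂ U] [SuperRep U] : Type u := QuadAlg (-1) U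

/-- An algebra with an action of `𝔤𝔩_{∞|∞}` for which the unit and the multiplication are maps
of representations (of super degree zero). -/
class SuperAlgebra (B : Type u) [Ring B] [Algebra ℂ B] [SuperRep B] : Prop where
  parity_one : parity (1 : B) = 1
  act_one : ∀ i j, act i j (1 : B) = 0
  parity_mul : ∀ x y : B, parity (x * y) = parity x * parity y
  act_mul : ∀ (i j) (x y : B),
    act i j (x * y) = act i j x * y + parityPow B (par i + par j) x * act i j y

namespace QuadAlg

variable {ε : ℂ} {U : Type u} [AddCommGroup U] [Module ℂ U] [SuperRep U]

instance : Ring (QuadAlg ε U) := inferInstanceAs (Ring (RingQuot (QuadRel ε U)))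

instance : Algebra ℂ (QuadAlg ε U) := inferInstanceAs (Algebra ℂ (RingQuot (QuadRel ε U)))

/-- The projection from the tensor algebra. -/
def mk : TensorAlgebra ℂ U →ₐ[ℂ] QuadAlg ε U := RingQuot.mkAlgHom ℂ (QuadRel ε U)

/-- The inclusion of the generators. -/
def ι : U →ₗ[ℂ] QuadAlg ε U := (mk (ε := ε)).toLinearMap ∘ₗ TensorAlgebra.ι ℂ

theorem ι_mul_ι {p q : ZMod 2} {u w : U} (hu : IsHomog p u) (hw : IsHomog q w) :
    (ι u * ι w : QuadAlg ε U) = (ε * sgn (p * q)) • (ι w * ι u) := by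
  have := RingQuot.mkAlgHom_rel ℂ (QuadRel.swap (ε := ε) p q u w hu hw)
  rw [map_mul, map_smul, map_mul] at this
  exact this

/-- The universal property. -/
def lift {B : Type v} [Ring B] [Algebra ℂ B] (f : U →ₗ[ℂ] B)
    (hf : ∀ p q u w, IsHomog p u → IsHomog q w →
      f u * f w = (ε * sgn (p * q)) • (f w * f u)) : QuadAlg ε U →ₐ[ℂ] B :=
  RingQuot.liftAlgHom ℂ ⟨TensorAlgebra.lift ℂ f, by
    rintro _ _ ⟨p, q, u, w, hu, hw⟩
    simpa using hf p q u w hu hw⟩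

theorem lift_ι {B : Type v} [Ring B] [Algebra ℂ B] (f : U →ₗ[ℂ] B)
    (hf : ∀ p q u w, IsHomog p u → IsHomog q w →
      f u * f w = (ε * sgn (p * q)) • (f w * f u)) (u : U) :
    lift f hf (ι u : QuadAlg ε U) = f u := by
  have := RingQuot.liftAlgHom_mkAlgHom_apply ℂ (s := QuadRel ε U) (TensorAlgebra.lift ℂ f)
    (by
      rintro _ _ ⟨p, q, u, w, hu, hw⟩
      simpa using hf p q u w hu hw) (TensorAlgebra.ι ℂ u)
  rw [TensorAlgebra.lift_ι_apply] at this
  exact this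

theorem induction {C : QuadAlg ε U → Prop} (scalar : ∀ r : ℂ, C (algebraMap ℂ _ r))
    (gen : ∀ u, C (ι u)) (mul : ∀ x y, C x → C y → C (x * y))
    (add : ∀ x y, C x → C y → C (x + y)) (x : QuadAlg ε U) : C x := by
  obtain ⟨y, rfl⟩ := RingQuot.mkAlgHom_surjective ℂ (QuadRel ε U) x
  change C (mk y)
  induction y using TensorAlgebra.induction with
  | algebraMap r => rw [AlgHom.commutes]; exact scalar r
  | ι u => exact gen u
  | mul a b ha hb => rw [map_mul]; exact mul _ _ ha hb
  | add a b ha hb => rw [map_add]; exact add _ _ ha hb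

/-- The parity automorphism, extending that of `U`. -/
def parityHom : QuadAlg ε U →ₐ[ℂ] QuadAlg ε U :=
  lift (ι ∘ₗ parity) fun p q u w hu hw => by
    have hu' : parity u = sgn p • u := hu
    have hw' : parity w = sgn q • w := hw
    simp only [LinearMap.comp_apply, hu', hw', map_smul, smul_mul_smul_comm, ι_mul_ι hu hw,
      smul_smul]
    congr 1; ring

@[simp] theorem parityHom_ι (u : U) : parityHom (ι u : QuadAlg ε U) = ι (parity u) :=
  lift_ι _ _ u

theorem parityHom_parityHom (x : QuadAlg ε U) : parityHom (parityHom x) = x := by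
  induction x using QuadAlg.induction with
  | scalar r => simp
  | gen u => simp [parity_parity]
  | mul a b ha hb => simp [ha, hb]
  | add a b ha hb => simp [ha, hb]

/-- The `p`-th power of the parity automorphism. -/
def parityHomPow (p : ZMod 2) : QuadAlg ε U →ₐ[ℂ] QuadAlg ε U :=
  if p = 0 then AlgHom.id ℂ _ else parityHom

@[simp] theorem parityHomPow_ι (p : ZMod 2) (u : U) :
    parityHomPow p (ι u : QuadAlg ε U) = ι (parityPow U p u) := by
  rcases zmod2_cases p with rfl | rfl <;> simp [parityHomPow, parityPow]

/-- The superderivation extending the action of `E_{ab}` on `U`, stored as the upper right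
entry of a homomorphism to upper triangular matrices. -/
def derHom (a b : Idx) : QuadAlg ε U →ₐ[ℂ] Matrix (Fin 2) (Fin 2) (QuadAlg ε U) :=
  lift
    { toFun := fun u => !![ι (parityPow U (par a + par b) u), ι (act a b u); 0, ι u]
      map_add' := fun u w => by
        ext i j; fin_cases i <;> fin_cases j <;> simp
      map_smul' := fun r u => by
        ext i j; fin_cases i <;> fin_cases j <;> simp }
    fun p q u w hu hw => by
      have h1 := ι_mul_ι (ε := ε) hu hw
      have h2 := ι_mul_ι (ε := ε) hu (hw.act a b)
      have h3 := ι_mul_ι (ε := ε) (hu.act a b) hw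
      have e := hu.parityPow (par a + par b)
      have e' := hw.parityPow (par a + par b)
      generalize par a + par b = s at *
      ext i j; fin_cases i <;> fin_cases j
      · simp only [LinearMap.coe_mk, AddHom.coe_mk, Matrix.mul_apply, Fin.sum_univ_two, e, e',
          map_smul, Matrix.smul_apply]
        simp [h1, smul_smul]
        ring_nf
      · simp [Matrix.mul_apply, Fin.sum_univ_two, e, e', h2, h3, smul_smul, add_mul, mul_add,
          sgn_add]
        have c1 : sgn (s * p) * (ε * (sgn (p * s) * sgn (p * q))) = ε * sgn (p * q) := by
          rw [mul_comm s p]; linear_combination (ε * sgn (p * q)) * sgn_mul_self (p * s)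
        rw [c1, add_comm]
        congr 2
        ring
      · simp [Matrix.mul_apply, Fin.sum_univ_two]
      · simp [Matrix.mul_apply, Fin.sum_univ_two, h1]

theorem derHom_ι (a b : Idx) (u : U) : derHom a b (ι u : QuadAlg ε U) =
    !![ι (parityPow U (par a + par b) u), ι (act a b u); 0, ι u] :=
  lift_ι _ _ u

theorem derHom_eq (a b : Idx) (x : QuadAlg ε U) :
    derHom a b x 0 0 = parityHomPow (par a + par b) x ∧ derHom a b x 1 0 = 0 ∧
      derHom a b x 1 1 = x := by
  induction x using QuadAlg.induction with
  | scalar r => simp [Matrix.algebraMap_matrix_apply]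
  | gen u => simp [derHom_ι]
  | mul x y hx hy => simp [Matrix.mul_apply, Fin.sum_univ_two, hx, hy]
  | add x y hx hy => simp [hx, hy]

/-- The superderivation of super degree `par a + par b` extending the action of `E_{ab}`
on `U`. -/
def der (a b : Idx) : Module.End ℂ (QuadAlg ε U) where
  toFun x := derHom a b x 0 1
  map_add' x y := by simp
  map_smul' r x := by simp

theorem der_ι (a b : Idx) (u : U) : der a b (ι u : QuadAlg ε U) = ι (act a b u) := by
  change derHom a b (ι u) 0 1 = _
  rw [derHom_ι]; simp

theorem der_scalar (a b : Idx) (r : ℂ) : der a b (algebraMap ℂ (QuadAlg ε U) r) = 0 := by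
  change derHom a b _ 0 1 = _
  simp [Matrix.algebraMap_matrix_apply]

theorem der_mul (a b : Idx) (x y : QuadAlg ε U) :
    der a b (x * y) = der a b x * y + parityHomPow (par a + par b) x * der a b y := by
  change derHom a b (x * y) 0 1 = derHom a b x 0 1 * y + _ * derHom a b y 0 1
  rw [map_mul, Matrix.mul_apply, Fin.sum_univ_two, (derHom_eq a b x).1, (derHom_eq a b y).2.2,
    add_comm]

theorem parityHomPow_parityHomPow (p q : ZMod 2) (x : QuadAlg ε U) :
    parityHomPow p (parityHomPow q x) = parityHomPow (p + q) x := by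
  have h : (1 : ZMod 2) + 1 = 0 := by decide
  rcases zmod2_cases p with rfl | rfl <;> rcases zmod2_cases q with rfl | rfl <;>
    simp [parityHomPow, h, parityHom_parityHom]

theorem parityHomPow_der (p : ZMod 2) (a b : Idx) (x : QuadAlg ε U) :
    parityHomPow p (der a b x) =
      sgn (p * (par a + par b)) • der a b (parityHomPow p x) := by
  induction x using QuadAlg.induction with
  | scalar r => simp [der_scalar]
  | gen u => rw [der_ι, parityHomPow_ι, parityHomPow_ι, der_ι, parityPow_act, map_smul]
  | mul x y hx hy =>
    rw [der_mul, map_add, map_mul, map_mul, map_mul, der_mul, hx, hy, smul_add,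
      parityHomPow_parityHomPow, parityHomPow_parityHomPow, smul_mul_assoc, mul_smul_comm,
      add_comm p]
  | add x y hx hy => simp only [map_add, hx, hy, smul_add]

theorem der_bracket (a b c d : Idx) (x : QuadAlg ε U) :
    der a b (der c d x) - sgn ((par a + par b) * (par c + par d)) • der c d (der a b x) =
      (if b = c then der a d x else 0) -
        sgn ((par a + par b) * (par c + par d)) • (if d = a then der c b x else 0) := by
  induction x using QuadAlg.induction with
  | scalar r => simp [der_scalar]
  | gen u =>
    have := congrArg (ι (ε := ε)) (bracket a b c d u)
    simp only [der_ι]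
    rw [map_sub, map_smul, map_sub, map_smul] at this
    rw [this]
    split_ifs <;> simp
  | add x y hx hy =>
    simp only [map_add, smul_add]
    rw [add_sub_add_comm, hx, hy]
    split_ifs <;> simp only [smul_add, smul_zero] <;> abel
  | mul x y hx hy =>
    have e1 : b = c → par a + par d = (par a + par b) + (par c + par d) := by
      rintro rfl; linear_combination -add_self (par b)
    have e2 : d = a → par c + par b = (par a + par b) + (par c + par d) := by
      rintro rfl; linear_combination -add_self (par d)
    have r1 : (if b = c then der a d (x * y) else 0) = (if b = c then der a d x else 0) * y +
        parityHomPow ((par a + par b) + (par c + par d)) x *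
          (if b = c then der a d y else 0) := by
      split_ifs with h
      · rw [der_mul, e1 h]
      · simp
    have r2 : (if d = a then der c b (x * y) else 0) = (if d = a then der c b x else 0) * y +
        parityHomPow ((par a + par b) + (par c + par d)) x *
          (if d = a then der c b y else 0) := by
      split_ifs with h
      · rw [der_mul, e2 h]
      · simp
    rw [r1, r2]
    generalize (if b = c then der a d x else 0) = X1 at *
    generalize (if b = c then der a d y else 0) = Y1 at *
    generalize (if d = a then der c b x else 0) = X2 at *
    generalize (if d = a then der c b y else 0) = Y2 at *
    rw [der_mul, der_mul, map_add, map_add, der_mul, der_mul, der_mul, der_mul,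
      parityHomPow_der, parityHomPow_der, parityHomPow_parityHomPow, parityHomPow_parityHomPow,
      add_comm (par c + par d) (par a + par b), mul_comm (par c + par d) (par a + par b)]
    rw [sub_eq_iff_eq_add] at hx hy
    rw [hx, hy]
    have hs := sgn_mul_self ((par a + par b) * (par c + par d))
    generalize sgn ((par a + par b) * (par c + par d)) = s at *
    simp only [add_mul, mul_add, sub_mul, mul_sub, smul_add, smul_mul_assoc,
      mul_smul_comm, smul_smul, hs, one_smul]
    abel

instance : SuperRep (QuadAlg ε U) where
  parity := parityHom.toLinearMap
  act := der
  parity_parity := parityHom_parityHom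
  parity_act a b x := by
    have := parityHomPow_der 1 a b x
    simpa [parityHomPow] using this
  bracket := der_bracket

theorem parityPow_eq (p : ZMod 2) (x : QuadAlg ε U) :
    parityPow (QuadAlg ε U) p x = parityHomPow p x := by
  rcases zmod2_cases p with rfl | rfl
  · simp [parityPow, parityHomPow]
  · simp only [parityPow, parityHomPow, one_ne_zero, if_false]; rfl

instance : SuperAlgebra (QuadAlg ε U) where
  parity_one := map_one parityHom
  act_one i j := by
    have := der_scalar (ε := ε) (U := U) i j 1
    rwa [map_one] at this
  parity_mul := map_mul parityHom
  act_mul i j x y := by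
    rw [parityPow_eq]
    exact der_mul i j x y

end QuadAlg

/-! ### The two algebras -/

/-- The defining representation `𝕍 = ℂ^{∞|∞}`, as the first tensor power of itself. -/
abbrev Vee : Type := TPow 1

/-- `Sym²(𝕍)`, the degree two part of `Sym(𝕍)`: the span of the products of two
elements of `𝕍`. -/
def Sym2 : Submodule ℂ (SymAlg Vee) :=
  Submodule.span ℂ {x | ∃ v w : Vee, x = QuadAlg.ι v * QuadAlg.ι w}

theorem sym2_isStable : IsStable Sym2 where
  parity_mem := by
    intro m hm
    refine Submodule.span_induction (p := fun m _ => parity m ∈ Sym2) ?_ ?_ ?_ ?_ hm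
    · rintro _ ⟨v, w, rfl⟩
      rw [SuperAlgebra.parity_mul]
      refine Submodule.subset_span ⟨parity v, parity w, ?_⟩
      rw [← QuadAlg.parityHom_ι, ← QuadAlg.parityHom_ι]; rfl
    · simp
    · intro x y _ _ hx hy; rw [map_add]; exact add_mem hx hy
    · intro r x _ hx; rw [map_smul]; exact Submodule.smul_mem _ _ hx
  act_mem := by
    intro a b m hm
    refine Submodule.span_induction (p := fun m _ => act a b m ∈ Sym2) ?_ ?_ ?_ ?_ hm
    · rintro _ ⟨v, w, rfl⟩
      rw [SuperAlgebra.act_mul, QuadAlg.parityPow_eq, QuadAlg.parityHomPow_ι]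
      have e : ∀ u : Vee, act a b (QuadAlg.ι u : SymAlg Vee) = QuadAlg.ι (act a b u) :=
        QuadAlg.der_ι a b
      rw [e, e]
      exact add_mem (Submodule.subset_span ⟨_, _, rfl⟩) (Submodule.subset_span ⟨_, _, rfl⟩)
    · simp
    · intro x y _ _ hx hy; rw [map_add]; exact add_mem hx hy
    · intro r x _ hx; rw [map_smul]; exact Submodule.smul_mem _ _ hx

instance : SuperRep Sym2 := sym2_isStable.superRep

/-- `A = Sym(Sym²(𝕍)[1])`. -/
abbrev A : Type := SymAlg (Shift 1 Sym2)

/-- `A' = ⋀(Sym²(𝕍))`. -/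
abbrev A' : Type := ExtAlg Sym2

/-! ### Modules in the category of polynomial representations -/

open CategoryTheory

section Modules

variable (B : Type) [Ring B] [Algebra ℂ B] [SuperRep B]

/-- A module for the algebra `B` in the category of polynomial representations of `GL_{∞|∞}`:
a polynomial representation with a (left) `B`-module structure whose multiplication map
`B ⊗ M → M` is a map of representations (of super degree zero). -/
structure EqMod where
  carrier : Type u
  [addCommGroup : AddCommGroup carrier]
  [module : Module ℂ carrier]
  [superRep : SuperRep carrier]
  [moduleB : Module B carrier]
  [isScalarTower : IsScalarTower ℂ B carrier]
  polynomial : IsPolynomial carrier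
  parity_smul : ∀ (x : B) (m : carrier), parity (x • m) = parity x • parity m
  act_smul : ∀ (i j) (x : B) (m : carrier),
    act i j (x • m) = act i j x • m + parityPow B (par i + par j) x • act i j m

attribute [instance] EqMod.addCommGroup EqMod.module EqMod.superRep EqMod.moduleB
  EqMod.isScalarTower

variable {B}

namespace EqMod

/-- The space of homomorphisms: the maps that commute with `B`, with `𝔤𝔩_{∞|∞}` and
with the parity operators. -/
def homs (M N : EqMod.{u} B) : Submodule ℂ (M.carrier →ₗ[ℂ] N.carrier) where
  carrier := {f | (∀ (x : B) m, f (x • m) = x • f m) ∧ (∀ m, f (parity m) = parity (f m)) ∧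
    ∀ i j m, f (act i j m) = act i j (f m)}
  add_mem' := by
    rintro f g ⟨h1, h2, h3⟩ ⟨k1, k2, k3⟩
    refine ⟨fun x m => ?_, fun m => ?_, fun i j m => ?_⟩
    · simp [h1, k1]
    · simp [h2, k2]
    · simp [h3, k3]
  zero_mem' := by
    refine ⟨fun x m => ?_, fun m => ?_, fun i j m => ?_⟩ <;> simp
  smul_mem' := by
    rintro r f ⟨h1, h2, h3⟩
    refine ⟨fun x m => ?_, fun m => ?_, fun i j m => ?_⟩
    · rw [LinearMap.smul_apply, LinearMap.smul_apply, h1, ← algebraMap_smul B r (f m),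
        ← algebraMap_smul B r (x • f m), smul_smul, smul_smul, Algebra.commutes]
    · simp [h2]
    · simp [h3]

instance : Category (EqMod.{u} B) where
  Hom M N := homs M N
  id M := ⟨LinearMap.id, by refine ⟨?_, ?_, ?_⟩ <;> intros <;> rfl⟩
  comp f g := ⟨g.1 ∘ₗ f.1, by
    obtain ⟨f, h1, h2, h3⟩ := f
    obtain ⟨g, k1, k2, k3⟩ := g
    refine ⟨fun x m => ?_, fun m => ?_, fun i j m => ?_⟩
    · simp [h1, k1]
    · simp [h2, k2]
    · simp [h3, k3]⟩

instance homAddCommGroup (M N : EqMod.{u} B) : AddCommGroup (M ⟶ N) :=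
  inferInstanceAs (AddCommGroup (homs M N))

instance homModule (M N : EqMod.{u} B) : Module ℂ (M ⟶ N) :=
  inferInstanceAs (Module ℂ (homs M N))

instance : Preadditive (EqMod.{u} B) where
  homGroup M N := homAddCommGroup M N
  add_comp _ _ _ f g h := Subtype.ext (LinearMap.comp_add f.1 g.1 h.1)
  comp_add _ _ _ f g h := Subtype.ext (LinearMap.add_comp f.1 h.1 g.1)

instance : Linear ℂ (EqMod.{u} B) where
  homModule M N := homModule M N
  smul_comp _ _ _ r f g := Subtype.ext (LinearMap.comp_smul g.1 r f.1)
  comp_smul _ _ _ f r g := Subtype.ext (LinearMap.smul_comp r g.1 f.1)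

/-- A submodule in the category of polynomial representations: a `B`-submodule that is a
subrepresentation (automatically polynomial, by semisimplicity). -/
structure IsSubmodule (M : EqMod.{u} B) (N : Submodule B M.carrier) : Prop where
  parity_mem : ∀ m ∈ N, parity m ∈ N
  act_mem : ∀ i j, ∀ m ∈ N, act i j m ∈ N

/-- The submodule `N` is finitely generated: it is the smallest
submodule (in the category of polynomial representations) containing some finite set. -/
def IsFG (M : EqMod.{u} B) (N : Submodule B M.carrier) : Prop :=
  ∃ s : Finset M.carrier, (s : Set M.carrier) ⊆ N ∧
    ∀ N' : Submodule B M.carrier, M.IsSubmodule N' → (s : Set M.carrier) ⊆ N' → N ≤ N'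

end EqMod

variable (B) in
/-- `B` is noetherian: every submodule of a finitely generated `B`-module is finitely
generated. -/
def IsNoeth : Prop :=
  ∀ M : EqMod.{u} B, M.IsFG ⊤ → ∀ N : Submodule B M.carrier, M.IsSubmodule N → M.IsFG N

end Modules

end SuperTCA

end

noncomputable section

namespace SuperTCA

open scoped DirectSum
open SuperRep

/-! ### The polynomial degree -/

section Degree

variable {M : Type u} [AddCommGroup M] [Module ℂ M] [SuperRep M]
variable {N : Type v} [AddCommGroup N] [Module ℂ N] [SuperRep N]

/-! A polynomial representation splits by polynomial degree: the Euler operator `∑ E_{aa}` acts on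
`𝐒_λ(𝕍)` as the scalar `|λ|`. Let D be the operator `(-1) ^ ⌊n / 2⌋` in degree n (`degSign`) and P
the parity operator. D commutes with the Lie superalgebra and with P, and it anticommutes with every
generator of the two algebras, because these have degree two.

Given an A-module M, keep the space and the action of `𝔤𝔩_{∞|∞}`, replace P by PD, and let the
generator u of A' act as uP. Changing the parity of u by one alters three signs, and each is
compensated. The multiplication preserves parity because D anticommutes with u. It is equivariant
because P commutes with an odd matrix unit only up to sign (`act_twistHom`). The commutation rule
changes by the overall sign -1, which turns Sym into ⋀, because moving P past a generator produces a
sign (`twistGen_swap`).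

The way back uses uPD in terms of the parity operator P of the module being twisted; after the first
twist this operator is (PD)D = P, so u acts as uPP = u. Both composites are thus the identity on
underlying spaces, and the equivalence is linear. Subrepresentations are stable under D, since D is
locally a polynomial in Euler operators (`degSign_mem`). Hence a module and its twist have the same
submodules, the same finitely generated ones, and noetherianity transfers. -/

variable (M) in
/-- The truncation to the finite set `T` of the Euler operator `∑ E_{aa}`. -/
def euler (T : Finset Idx) : Module.End ℂ M := ∑ a ∈ T, act a a

theorem euler_apply (T : Finset Idx) (m : M) : euler M T m = ∑ a ∈ T, act a a m := by
  simp [euler]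

/-- `m` is homogeneous of polynomial degree `n`. -/
def IsDeg (n : ℕ) (m : M) : Prop :=
  ∃ S : Finset Idx, ∀ T, S ⊆ T → euler M T m = (n : ℂ) • m

theorem IsDeg.zero (n : ℕ) : IsDeg n (0 : M) := ⟨∅, fun T _ => by simp⟩

theorem IsDeg.add {n : ℕ} {x y : M} (hx : IsDeg n x) (hy : IsDeg n y) : IsDeg n (x + y) := by
  classical
  obtain ⟨S, hS⟩ := hx
  obtain ⟨S', hS'⟩ := hy
  refine ⟨S ∪ S', fun T hT => ?_⟩
  rw [map_add, hS T (Finset.union_subset_left hT), hS' T (Finset.union_subset_right hT), smul_add]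

theorem IsDeg.smul {n : ℕ} {x : M} (hx : IsDeg n x) (r : ℂ) : IsDeg n (r • x) := by
  obtain ⟨S, hS⟩ := hx
  exact ⟨S, fun T hT => by rw [map_smul, hS T hT, smul_comm]⟩

theorem IsDeg.map {n : ℕ} {x : M} (hx : IsDeg n x) (f : M →ₗ[ℂ] N)
    (hf : ∀ a b m, f (act a b m) = act a b (f m)) : IsDeg n (f x) := by
  obtain ⟨S, hS⟩ := hx
  refine ⟨S, fun T hT => ?_⟩
  rw [← map_smul, ← hS T hT, euler_apply, euler_apply, map_sum]
  simp_rw [hf]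

theorem IsDeg.of_injective {n : ℕ} {x : M} (f : M →ₗ[ℂ] N)
    (hf : ∀ a b m, f (act a b m) = act a b (f m)) (hi : Function.Injective f)
    (hx : IsDeg n (f x)) : IsDeg n x := by
  obtain ⟨S, hS⟩ := hx
  refine ⟨S, fun T hT => hi ?_⟩
  rw [map_smul, ← hS T hT, euler_apply, euler_apply, map_sum]
  simp_rw [hf]

/-- On a common large `T`, both degrees are eigenvalues of one operator at `x`, and distinct
naturals stay distinct in `ℂ`. -/
theorem IsDeg.eq_or_eq_zero {n k : ℕ} {x : M} (hn : IsDeg n x) (hk : IsDeg k x) :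
    n = k ∨ x = 0 := by
  classical
  obtain ⟨S, hS⟩ := hn
  obtain ⟨S', hS'⟩ := hk
  have h := (hS _ Finset.subset_union_left).symm.trans (hS' (S ∪ S') Finset.subset_union_right)
  rw [← sub_eq_zero, ← sub_smul, smul_eq_zero, sub_eq_zero, Nat.cast_inj] at h
  exact h

theorem IsDeg.parity {n : ℕ} {x : M} (hx : IsDeg n x) : IsDeg n (parity x) := by
  obtain ⟨S, hS⟩ := hx
  refine ⟨S, fun T hT => ?_⟩
  rw [← map_smul, ← hS T hT, euler_apply, euler_apply, map_sum]
  exact Finset.sum_congr rfl fun a _ => by rw [parity_act, add_self, sgn_zero, one_smul]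

/-- The terms `c = a` and `c = b` of the commutator `[∑ E_{cc}, E_{ab}]` contribute `E_{ab}` and
`-E_{ab}`. Both must occur in the truncation, hence the two membership hypotheses. -/
theorem euler_act {T : Finset Idx} {a b : Idx} (ha : a ∈ T) (hb : b ∈ T) (m : M) :
    euler M T (act a b m) = act a b (euler M T m) := by
  rw [← sub_eq_zero, euler_apply, euler_apply, map_sum, ← Finset.sum_sub_distrib]
  have h : ∀ c, act c c (act a b m) - act a b (act c c m) =
      (if c = a then act c b m else 0) - (if b = c then act a c m else 0) := fun c => by
    simpa [add_self] using bracket c c a b m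
  simp_rw [h]
  simp [Finset.sum_sub_distrib, Finset.sum_ite_eq, Finset.sum_ite_eq', ha, hb]

theorem IsDeg.act {n : ℕ} {x : M} (hx : IsDeg n x) (a b : Idx) : IsDeg n (act a b x) := by
  classical
  obtain ⟨S, hS⟩ := hx
  refine ⟨insert a (insert b S), fun T hT => ?_⟩
  rw [euler_act (hT (by simp)) (hT (by simp)), hS T fun c hc => hT (by simp [hc]), map_smul]

theorem tpow_isDeg {n : ℕ} (x : TPow n) : IsDeg n x := by
  classical
  induction x using Finsupp.induction_linear with
  | zero => exact IsDeg.zero n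
  | add x y hx hy => exact hx.add hy
  | single w r =>
    have e : (Finsupp.single w r : TPow n) = r • Finsupp.single w 1 := by simp
    rw [e]
    refine IsDeg.smul ⟨Finset.univ.image w, fun T hT => ?_⟩ r
    rw [euler_apply]
    change ∑ a ∈ T, (∑ k, posAct k a a) (Finsupp.single w 1) = _
    simp_rw [LinearMap.sum_apply]
    rw [Finset.sum_comm]
    -- Each tensor position contributes exactly once, through the letter `a = w k`; there are `n`
    -- positions.
    have h : ∀ k : Fin n, ∑ a ∈ T, posAct k a a (Finsupp.single w 1) = Finsupp.single w 1 := by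
      intro k
      rw [Finset.sum_eq_single (w k)]
      · rw [posAct_single, if_pos rfl, add_self, zero_mul, sgn_zero, one_smul,
          Function.update_eq_self]
      · intro a _ ha
        rw [posAct_single, if_neg (Ne.symm ha)]
      · exact fun h => (h (hT (by simp))).elim
    simp_rw [h]
    rw [Finset.sum_const, Finset.card_univ, Fintype.card_fin, Nat.cast_smul_eq_nsmul]

/-- The degree depends only on `act`, which the shift leaves unchanged and which `Schur μ` inherits
from the tensor power. -/
theorem shift_schur_isDeg (p : ZMod 2) (μ : YoungDiagram) (x : Shift p (Schur μ)) :
    IsDeg μ.card x :=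
  IsDeg.of_injective (M := Schur μ) (Schur μ).subtype (fun _ _ _ => rfl)
    Subtype.val_injective (tpow_isDeg _)

end Degree

/-! ### The sign `(-1) ^ ⌊n / 2⌋` in polynomial degree `n` -/

/-- The sign `(-1) ^ ⌊n / 2⌋`. -/
def halfSign (n : ℕ) : ℂ := sgn ((n / 2 : ℕ) : ZMod 2)

theorem halfSign_mul_self (n : ℕ) : halfSign n * halfSign n = 1 := sgn_mul_self _

/-- The reason for halving the degree: multiplication by a generator of degree two flips the sign.
The floor only serves to cover odd degrees as well. -/
theorem halfSign_two_add (n : ℕ) : halfSign (2 + n) = -halfSign n := by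
  have h : (2 + n) / 2 = n / 2 + 1 := by omega
  rw [halfSign, h, Nat.cast_add, sgn_add, Nat.cast_one, sgn_one, mul_neg_one, halfSign]

section DegSign

variable {M : Type u} [AddCommGroup M] [Module ℂ M] [SuperRep M]

theorem IsDeg.halfSign_smul {n k : ℕ} {m : M} (hn : IsDeg n m) (hk : IsDeg k m) :
    halfSign k • m = halfSign n • m := by
  rcases hn.eq_or_eq_zero hk with h | h
  · rw [h]
  · rw [h, smul_zero, smul_zero]

theorem RepEquiv.symm_map_act {N : Type v} [AddCommGroup N] [Module ℂ N] [SuperRep N]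
    (φ : RepEquiv M N) (a b : Idx) (y : N) :
    φ.toLinearEquiv.symm (act a b y) = act a b (φ.toLinearEquiv.symm y) := by
  rw [LinearEquiv.symm_apply_eq]
  exact (congrArg (act a b) (φ.toLinearEquiv.apply_symm_apply y).symm).trans (φ.map_act a b _).symm

/-- Elements of a polynomial representation are sums of homogeneous ones, so additive identities may
be checked where `degSign` is a scalar. -/
theorem IsPolynomial.induction (hM : IsPolynomial M) {C : M → Prop}
    (deg : ∀ n m, IsDeg n m → C m) (add : ∀ x y, C x → C y → C (x + y)) (m : M) : C m := by
  classical
  obtain ⟨I, lam, p, ⟨φ⟩⟩ := hM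
  obtain ⟨y, rfl⟩ := φ.toLinearEquiv.symm.surjective m
  induction y using DirectSum.induction_on (β := fun i => Shift (p i) (Schur (lam i))) with
  | zero => rw [map_zero]; exact deg 0 _ (IsDeg.zero 0)
  | add x y hx hy => rw [map_add]; exact add _ _ hx hy
  | of i x =>
    refine deg (lam i).card _ (IsDeg.map ?_ φ.toLinearEquiv.symm.toLinearMap φ.symm_map_act)
    refine (shift_schur_isDeg _ _ x).map
      (DirectSum.lof ℂ I (fun i => Shift (p i) (Schur (lam i))) i) fun a b m => ?_
    exact (DirectSum.lmap_lof (fun i => (act a b : Module.End ℂ (Shift (p i) (Schur (lam i))))) i m).symm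

/-- The operator is transported from the direct sum, where it is a scalar on each summand. A
component of an element of degree `n` vanishes unless its summand has degree `n`, so the choice of
decomposition does not matter. -/
theorem IsPolynomial.exists_degSign (hM : IsPolynomial M) :
    ∃ D : Module.End ℂ M, ∀ n m, IsDeg n m → D m = halfSign n • m := by
  obtain ⟨I, lam, p, ⟨φ⟩⟩ := hM
  refine ⟨φ.toLinearEquiv.symm.toLinearMap ∘ₗ
    (DirectSum.lmap fun i => halfSign (lam i).card • LinearMap.id) ∘ₗ
      φ.toLinearEquiv.toLinearMap, fun n m hm => ?_⟩
  refine (LinearEquiv.symm_apply_eq _).2 (DFinsupp.ext fun i => ?_)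
  rw [map_smul]
  exact ((hm.map φ.toLinearEquiv.toLinearMap φ.map_act).map
    (DirectSum.component ℂ I (fun i => Shift (p i) (Schur (lam i))) i)
      fun _ _ _ => rfl).halfSign_smul (shift_schur_isDeg _ _ _)

/-- The operator `(-1) ^ ⌊n / 2⌋` on the part of polynomial degree `n`. -/
def degSign (hM : IsPolynomial M) : Module.End ℂ M := hM.exists_degSign.choose

theorem IsDeg.degSign (hM : IsPolynomial M) {n : ℕ} {m : M} (hm : IsDeg n m) :
    degSign hM m = halfSign n • m :=
  hM.exists_degSign.choose_spec n m hm

variable (hM : IsPolynomial M)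

theorem degSign_degSign (m : M) : degSign hM (degSign hM m) = m := by
  induction m using hM.induction with
  | deg n m hm => rw [hm.degSign, map_smul, hm.degSign, smul_smul, halfSign_mul_self, one_smul]
  | add x y hx hy => simp only [map_add, hx, hy]

theorem degSign_parity (m : M) : degSign hM (parity m) = parity (degSign hM m) := by
  induction m using hM.induction with
  | deg n m hm => rw [hm.degSign, hm.parity.degSign, map_smul]
  | add x y hx hy => simp only [map_add, hx, hy]

theorem degSign_act (a b : Idx) (m : M) : degSign hM (act a b m) = act a b (degSign hM m) := by
  induction m using hM.induction with
  | deg n m hm => rw [hm.degSign, (hm.act a b).degSign, map_smul]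
  | add x y hx hy => simp only [map_add, hx, hy]

theorem map_degSign {N : Type v} [AddCommGroup N] [Module ℂ N] [SuperRep N] (hN : IsPolynomial N)
    (f : M →ₗ[ℂ] N) (hf : ∀ a b m, f (act a b m) = act a b (f m)) (m : M) :
    f (degSign hM m) = degSign hN (f m) := by
  induction m using hM.induction with
  | deg n m hm => rw [hm.degSign, (hm.map f hf).degSign, map_smul]
  | add x y hx hy => simp only [map_add, hx, hy]

theorem map_degSign_of_isDeg {N : Type v} [AddCommGroup N] [Module ℂ N] [SuperRep N]
    (f : M →ₗ[ℂ] N) (hf : ∀ a b m, f (act a b m) = act a b (f m)) {k : ℕ}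
    (hN : ∀ x : N, IsDeg k x) (m : M) : f (degSign hM m) = halfSign k • f m := by
  induction m using hM.induction with
  | deg n m hm => rw [hm.degSign, map_smul, (hm.map f hf).halfSign_smul (hN _)]
  | add x y hx hy => simp only [map_add, hx, hy, smul_add]

/-- On each element, `degSign` is given by a polynomial in the Euler operator. -/
theorem exists_degSign_eq_aeval (m : M) :
    ∃ (T : Finset Idx) (p : Polynomial ℂ), degSign hM m = Polynomial.aeval (euler M T) p m := by
  classical
  -- Quantifying over all large `T` and all `p` with the right values at `0, …, n` lets two summands
  -- share one `T` and one `p`; interpolation then supplies such a `p`.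
  obtain ⟨S, n, h⟩ : ∃ (S : Finset Idx) (n : ℕ), ∀ T, S ⊆ T → ∀ p : Polynomial ℂ,
      (∀ k ≤ n, p.eval (k : ℂ) = halfSign k) →
        Polynomial.aeval (euler M T) p m = degSign hM m := by
    induction m using hM.induction with
    | deg n m hm =>
      obtain ⟨S, hS⟩ := hm
      refine ⟨S, n, fun T hT p hp => ?_⟩
      rw [IsDeg.degSign hM ⟨S, hS⟩, ← hp n le_rfl]
      exact Module.End.aeval_apply_of_mem_apply_eq_smul (hS T hT)
    | add x y hx hy =>
      obtain ⟨S, n, h⟩ := hx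
      obtain ⟨S', n', h'⟩ := hy
      refine ⟨S ∪ S', max n n', fun T hT p hp => ?_⟩
      rw [map_add, map_add, h T (Finset.union_subset_left hT) p fun k hk => hp k (by omega),
        h' T (Finset.union_subset_right hT) p fun k hk => hp k (by omega)]
  refine ⟨S, Lagrange.interpolate (Finset.range (n + 1)) (fun k : ℕ => (k : ℂ)) halfSign,
    (h S subset_rfl _ fun k hk => ?_).symm⟩
  exact Lagrange.eval_interpolate_at_node _ (fun _ _ _ _ h => Nat.cast_injective h)
    (Finset.mem_range.2 (by omega))

/-- Stability under `act` suffices, with no appeal to `W` being polynomial: a polynomial in a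
truncated Euler operator preserves `W`. -/
theorem degSign_mem {W : Submodule ℂ M} (hW : ∀ a b, ∀ m ∈ W, act a b m ∈ W) {m : M}
    (hm : m ∈ W) : degSign hM m ∈ W := by
  obtain ⟨T, p, h⟩ := exists_degSign_eq_aeval hM m
  rw [h]
  refine Polynomial.aeval_apply_smul_mem_of_le_comap hm p _ fun x hx => ?_
  rw [Submodule.mem_comap, euler_apply]
  exact sum_mem fun a _ => hW a a x hx

end DegSign

/-! ### Reversing the parity of the generators -/

section TwistOp

variable {M : Type u} [AddCommGroup M] [Module ℂ M] [SuperRep M] (hM : IsPolynomial M)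

/-- The representation `M` with its super grading shifted by `⌊n / 2⌋` in polynomial degree `n`. -/
abbrev twistRep : SuperRep M where
  parity := parity * degSign hM
  act := act
  parity_parity m := by simp [degSign_parity, degSign_degSign, parity_parity]
  parity_act a b m := by simp [degSign_act, parity_act]
  bracket := bracket

/-- The identity map between two shifts of `M`. -/
def shiftCongr (p q : ZMod 2) : Shift p M ≃ₗ[ℂ] Shift q M := LinearEquiv.refl ℂ M

theorem shiftCongr_parity (p q : ZMod 2) (x : Shift p M) :
    shiftCongr p (p + q) (parity (sgn q • x)) = parity (shiftCongr p (p + q) x) := by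
  have h : ∀ m : M, sgn p • parity (sgn q • m) = sgn (p + q) • parity m := fun m => by
    rw [map_smul, smul_smul, sgn_add]
  exact h x

/-- On a summand of degree `n`, `degSign` is a scalar sign, so the new parity just shifts that
summand further by `⌊n / 2⌋`. The same decomposition works with shifts `p i + q i`. -/
theorem twistRep_isPolynomial : @IsPolynomial M _ _ (twistRep hM) := by
  obtain ⟨I, lam, p, ⟨φ⟩⟩ := id hM
  let q : I → ZMod 2 := fun i => (((lam i).card / 2 : ℕ) : ZMod 2)
  let ψ : (⨁ i, Shift (p i) (Schur (lam i))) ≃ₗ[ℂ] ⨁ i, Shift (p i + q i) (Schur (lam i)) :=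
    DFinsupp.mapRange.linearEquiv fun i => shiftCongr (p i) (p i + q i)
  refine ⟨I, lam, fun i => p i + q i, ⟨@RepEquiv.mk _ _ _ _ (twistRep hM) _ _ _
    (φ.toLinearEquiv.trans ψ) (fun m => ?_) fun a b m => ?_⟩⟩
  · refine DFinsupp.ext fun i => ?_
    refine Eq.trans ?_ (shiftCongr_parity (p i) (q i) (φ.toLinearEquiv m i))
    refine congrArg (shiftCongr (p i) (p i + q i)) ?_
    have h1 : φ.toLinearEquiv (parity (degSign hM m)) i =
        (parity : Module.End ℂ (Shift (p i) (Schur (lam i)))) (φ.toLinearEquiv (degSign hM m) i) :=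
      DFunLike.congr_fun (φ.map_parity (degSign hM m)) i
    refine h1.trans (congrArg parity ?_)
    exact map_degSign_of_isDeg hM
      (DirectSum.component ℂ I (fun i => Shift (p i) (Schur (lam i))) i ∘ₗ
        φ.toLinearEquiv.toLinearMap)
      (fun a b m => DFunLike.congr_fun (φ.map_act a b m) i) (shift_schur_isDeg _ _) m
  · refine DFinsupp.ext fun i => ?_
    exact DFunLike.congr_fun (φ.map_act a b m) i

theorem twistRep_degSign (m : M) :
    @degSign M _ _ (twistRep hM) (twistRep_isPolynomial hM) m = degSign hM m := by
  induction m using hM.induction with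
  | deg n m hm =>
    rw [hm.degSign]
    exact @IsDeg.degSign M _ _ (twistRep hM) (twistRep_isPolynomial hM) n m hm
  | add x y hx hy => simp only [map_add, hx, hy]

/-- The parity operator of `M`, for `b = false`, or of `twistRep`, for `b = true`. -/
def twistOp (b : Bool) : Module.End ℂ M := bif b then parity * degSign hM else parity

theorem twistOp_twistOp (b : Bool) (m : M) : twistOp hM b (twistOp hM b m) = m := by
  cases b <;> simp [twistOp, degSign_parity, degSign_degSign, parity_parity]

theorem twistOp_act (b : Bool) (i j : Idx) (m : M) :
    twistOp hM b (act i j m) = sgn (par i + par j) • act i j (twistOp hM b m) := by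
  cases b <;> simp [twistOp, degSign_act, parity_act]

theorem parity_twistOp (b : Bool) (m : M) :
    parity (twistOp hM b m) = twistOp hM b (parity m) := by
  cases b <;> simp [twistOp, degSign_parity]

theorem degSign_twistOp (b : Bool) (m : M) :
    degSign hM (twistOp hM b m) = twistOp hM b (degSign hM m) := by
  cases b <;> simp [twistOp, degSign_parity]

/-- The new parity is PD and `degSign` is unchanged, so passing to `twistRep` exchanges the
operators P and PD. This is why the return twist uses `!b`. -/
theorem twistRep_twistOp (b : Bool) (m : M) :
    @twistOp M _ _ (twistRep hM) (twistRep_isPolynomial hM) (!b) m = twistOp hM b m := by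
  cases b
  · change parity (degSign hM (@degSign M _ _ (twistRep hM) (twistRep_isPolynomial hM) m)) = _
    rw [twistRep_degSign, degSign_degSign]; rfl
  · rfl

theorem map_twistOp {N : Type v} [AddCommGroup N] [Module ℂ N] [SuperRep N] (hN : IsPolynomial N)
    (f : M →ₗ[ℂ] N) (hp : ∀ m, f (parity m) = parity (f m))
    (hf : ∀ a b m, f (act a b m) = act a b (f m)) (b : Bool) (m : M) :
    f (twistOp hM b m) = twistOp hN b (f m) := by
  cases b <;> simp [twistOp, hp, map_degSign hM hN f hf]

theorem twistOp_mem {W : Submodule ℂ M} (hp : ∀ m ∈ W, parity m ∈ W)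
    (hW : ∀ a b, ∀ m ∈ W, act a b m ∈ W) (b : Bool) {m : M} (hm : m ∈ W) :
    twistOp hM b m ∈ W := by
  cases b
  · exact hp m hm
  · exact hp _ (degSign_mem hM hW hm)

end TwistOp

/-- An equivariant isomorphism `U' ≅ U[1]`, for `U` of polynomial degree two, and a pair of
opposite signs. -/
structure Reversal (ε ε' : ℂ) (U U' : Type) [AddCommGroup U] [Module ℂ U] [SuperRep U]
    [AddCommGroup U'] [Module ℂ U'] [SuperRep U'] where
  sign_eq : ε' = -ε
  equiv : U' ≃ₗ[ℂ] U
  map_parity : ∀ u, equiv (parity u) = -parity (equiv u)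
  map_act : ∀ a b u, equiv (act a b u) = act a b (equiv u)
  isDeg : ∀ u : U, IsDeg 2 u

variable {ε ε' : ℂ} {U U' : Type} [AddCommGroup U] [Module ℂ U] [SuperRep U]
  [AddCommGroup U'] [Module ℂ U'] [SuperRep U']

namespace Reversal

/-- The reversal in the other direction. -/
def symm (h : Reversal ε ε' U U') : Reversal ε' ε U' U where
  sign_eq := by rw [h.sign_eq, neg_neg]
  equiv := h.equiv.symm
  map_parity u := by
    rw [LinearEquiv.symm_apply_eq, map_neg, h.map_parity, h.equiv.apply_symm_apply, neg_neg]
  map_act a b u := by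
    rw [LinearEquiv.symm_apply_eq, h.map_act, h.equiv.apply_symm_apply]
  isDeg u := (h.isDeg (h.equiv u)).of_injective h.equiv.toLinearMap h.map_act h.equiv.injective

end Reversal

/-! ### Twisting a module along a reversal -/

namespace EqMod

/-- The `E_{aa}` are even, so the Euler operator obeys the Leibniz rule without signs. -/
theorem isDeg_smul {B : Type} [Ring B] [Algebra ℂ B] [SuperRep B] (M : EqMod.{u} B) {k n : ℕ}
    {x : B} {m : M.carrier} (hx : IsDeg k x) (hm : IsDeg n m) : IsDeg (k + n) (x • m) := by
  classical
  obtain ⟨S, hS⟩ := hx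
  obtain ⟨S', hS'⟩ := hm
  refine ⟨S ∪ S', fun T hT => ?_⟩
  have h : euler M.carrier T (x • m) = euler B T x • m + x • euler M.carrier T m := by
    simp_rw [euler_apply, M.act_smul, add_self, parityPow_zero, Finset.sum_add_distrib,
      Finset.sum_smul, Finset.smul_sum]
  rw [h, hS T (Finset.union_subset_left hT), hS' T (Finset.union_subset_right hT), smul_assoc,
    smul_comm x, ← add_smul, Nat.cast_add]

theorem degSign_ι_smul (hU : ∀ u : U, IsDeg 2 u) (M : EqMod.{u} (QuadAlg ε U)) (u : U)
    (m : M.carrier) : degSign M.polynomial ((QuadAlg.ι u : QuadAlg ε U) • m) =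
      -((QuadAlg.ι u : QuadAlg ε U) • degSign M.polynomial m) := by
  induction m using M.polynomial.induction with
  | deg n m hm =>
    rw [hm.degSign, (M.isDeg_smul ((hU u).map QuadAlg.ι fun a b u => (QuadAlg.der_ι a b u).symm)
      hm).degSign, halfSign_two_add, neg_smul, smul_comm (QuadAlg.ι u : QuadAlg ε U)]
  | add x y hx hy => simp only [map_add, smul_add, hx, hy, neg_add]

theorem parity_ι_smul (M : EqMod.{u} (QuadAlg ε U)) (u : U) (m : M.carrier) :
    parity ((QuadAlg.ι u : QuadAlg ε U) • m) = (QuadAlg.ι (parity u) : QuadAlg ε U) • parity m := by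
  rw [M.parity_smul, ← QuadAlg.parityHom_ι]; rfl

theorem act_ι_smul (M : EqMod.{u} (QuadAlg ε U)) (i j : Idx) (u : U) (m : M.carrier) :
    act i j ((QuadAlg.ι u : QuadAlg ε U) • m) = (QuadAlg.ι (act i j u) : QuadAlg ε U) • m +
      (QuadAlg.ι (parityPow U (par i + par j) u) : QuadAlg ε U) • act i j m := by
  rw [M.act_smul, ← QuadAlg.der_ι, QuadAlg.parityPow_eq, QuadAlg.parityHomPow_ι]; rfl

/-- The sign in `twistOp_ι_smul`. -/
def twistSign (b : Bool) : ℂ := bif b then -1 else 1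

theorem twistOp_ι_smul (hU : ∀ u : U, IsDeg 2 u) (M : EqMod.{u} (QuadAlg ε U)) (b : Bool) (u : U)
    (m : M.carrier) : twistOp M.polynomial b ((QuadAlg.ι u : QuadAlg ε U) • m) =
      twistSign b • (QuadAlg.ι (parity u) : QuadAlg ε U) • twistOp M.polynomial b m := by
  cases b
  · simp [twistOp, twistSign, parity_ι_smul]
  · simp [twistOp, twistSign, parity_ι_smul, degSign_ι_smul hU]

variable (h : Reversal ε ε' U U') (b : Bool) (M : EqMod.{u} (QuadAlg ε U))

/-- The generator `u` acts on the twist of `M` as `twistOp` followed by the generator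
corresponding to `u`. -/
def twistGen : U' →ₗ[ℂ] Module.End ℂ M.carrier :=
  LinearMap.mulRight ℂ (twistOp M.polynomial b) ∘ₗ
    (Algebra.lsmul ℂ ℂ M.carrier).toLinearMap ∘ₗ QuadAlg.ι (ε := ε) ∘ₗ h.equiv.toLinearMap

theorem twistGen_apply (u : U') (m : M.carrier) : twistGen h b M u m =
    (QuadAlg.ι (h.equiv u) : QuadAlg ε U) • twistOp M.polynomial b m := rfl

/-- Moving the first `twistOp` past the second generator costs a sign depending on `q`, and then the
two copies of `twistOp` cancel. In the other order the sign depends on `p`; the discrepancy turns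
the relation for `ε` into the one for `-ε`. -/
theorem twistGen_swap (p q : ZMod 2) (u w : U') (hu : IsHomog p u) (hw : IsHomog q w) :
    twistGen h b M u * twistGen h b M w =
      (ε' * sgn (p * q)) • (twistGen h b M w * twistGen h b M u) := by
  have key : ∀ {p : ZMod 2} {u : U'}, IsHomog p u → IsHomog (p + 1) (h.equiv u) := by
    intro p u hu
    have := h.map_parity u
    rw [hu, map_smul] at this
    rw [IsHomog, sgn_add, sgn_one, mul_neg_one, neg_smul, this, neg_neg]
  have aux : ∀ {p q : ZMod 2} {u w : U'}, IsHomog p u → IsHomog q w → ∀ m,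
      (twistGen h b M u * twistGen h b M w) m = (twistSign b * sgn (q + 1)) •
        ((QuadAlg.ι (h.equiv u) * QuadAlg.ι (h.equiv w) : QuadAlg ε U) • m) := by
    intro p q u w hu hw m
    have e : parity (h.equiv w) = sgn (q + 1) • h.equiv w := key hw
    rw [Module.End.mul_apply, twistGen_apply, twistGen_apply, twistOp_ι_smul h.isDeg,
      twistOp_twistOp, e, map_smul, smul_assoc, smul_comm _ (_ : ℂ), mul_smul (twistSign b),
      mul_smul (QuadAlg.ι _), smul_comm (QuadAlg.ι _ : QuadAlg ε U) (sgn _)]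
  refine LinearMap.ext fun m => ?_
  rw [LinearMap.smul_apply, aux hu hw, aux hw hu, QuadAlg.ι_mul_ι (key hu) (key hw), smul_assoc,
    smul_smul, smul_smul]
  -- The common factor `twistSign b` aside, the exponents agree: `(p + 1)(q + 1) + (q + 1) = 1 + pq
  -- + (p + 1)` modulo two.
  congr 1
  rw [h.sign_eq]
  have h2 : (1 : ZMod 2) + 1 = 0 := by decide
  rcases zmod2_cases p with rfl | rfl <;> rcases zmod2_cases q with rfl | rfl <;> simp [h2, mul_comm]

/-- The action on the twist of `M`. -/
def twistHom : QuadAlg ε' U' →ₐ[ℂ] Module.End ℂ M.carrier :=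
  QuadAlg.lift (twistGen h b M) (twistGen_swap h b M)

theorem twistHom_ι (u : U') (m : M.carrier) : twistHom h b M (QuadAlg.ι u) m =
    (QuadAlg.ι (h.equiv u) : QuadAlg ε U) • twistOp M.polynomial b m := by
  rw [twistHom, QuadAlg.lift_ι]; rfl

/-- On a generator two minus signs cancel: one from `degSign` crossing an element of degree two, one
from `h.map_parity`. -/
theorem parity_twistHom (x : QuadAlg ε' U') (m : M.carrier) :
    parity (degSign M.polynomial (twistHom h b M x m)) =
      twistHom h b M (QuadAlg.parityHom x) (parity (degSign M.polynomial m)) := by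
  induction x using QuadAlg.induction generalizing m with
  | scalar r => simp [Module.algebraMap_end_apply]
  | gen u =>
    rw [QuadAlg.parityHom_ι, twistHom_ι, twistHom_ι, degSign_ι_smul h.isDeg, map_neg,
      parity_ι_smul, h.map_parity, degSign_twistOp, parity_twistOp, map_neg, neg_smul]
  | mul x y hx hy => simp only [map_mul, Module.End.mul_apply, hx, hy]
  | add x y hx hy => simp only [map_add, LinearMap.add_apply, hx, hy]

/-- For an odd matrix unit, the Koszul sign changes with the parity of the generator, and `twistOp`
compensates by anticommuting with that matrix unit. -/
theorem act_twistHom (i j : Idx) (x : QuadAlg ε' U') (m : M.carrier) :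
    act i j (twistHom h b M x m) = twistHom h b M (QuadAlg.der i j x) m +
      twistHom h b M (QuadAlg.parityHomPow (par i + par j) x) (act i j m) := by
  induction x using QuadAlg.induction generalizing m with
  | scalar r => simp [Module.algebraMap_end_apply, QuadAlg.der_scalar]
  | gen u =>
    rw [QuadAlg.der_ι, QuadAlg.parityHomPow_ι, twistHom_ι, twistHom_ι, twistHom_ι, act_ι_smul,
      twistOp_act, h.map_act, smul_comm _ (sgn _), ← smul_assoc (sgn _), ← map_smul (QuadAlg.ι (ε := ε))]
    congr 3
    have e : (par i + par j = 0 ∨ par i + par j = 1) := zmod2_cases _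
    rcases e with e | e
    · simp [e, parityPow_zero]
    · simp [e, parityPow_one, h.map_parity]
  | mul x y hx hy =>
    simp only [map_mul, Module.End.mul_apply, hx, hy, QuadAlg.der_mul, map_add,
      LinearMap.add_apply, add_assoc]
  | add x y hx hy =>
    simp only [map_add, LinearMap.add_apply, hx, hy]
    abel

/-- The twist of the module `M` along a reversal. -/
def twist : EqMod.{u} (QuadAlg ε' U') :=
  letI := Module.compHom M.carrier (twistHom h b M).toRingHom
  { carrier := M.carrier
    superRep := twistRep M.polynomial
    isScalarTower := ⟨fun r x m => by
      change twistHom h b M (r • x) m = r • twistHom h b M x m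
      rw [map_smul, LinearMap.smul_apply]⟩
    polynomial := twistRep_isPolynomial M.polynomial
    parity_smul := parity_twistHom h b M
    act_smul := fun i j x m => by
      rw [QuadAlg.parityPow_eq]
      exact act_twistHom h b M i j x m }

end EqMod

open CategoryTheory

/-! ### The twist as an equivalence of categories -/

namespace EqMod

section Functor

variable (h : Reversal ε ε' U U') (b : Bool)

theorem map_twistHom {M N : EqMod.{u} (QuadAlg ε U)} (f : M ⟶ N) (x : QuadAlg ε' U')
    (m : M.carrier) : f.1 (twistHom h b M x m) = twistHom h b N x (f.1 m) := by
  obtain ⟨hB, hp, ha⟩ := f.2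
  induction x using QuadAlg.induction generalizing m with
  | scalar r => simp [Module.algebraMap_end_apply]
  | gen u =>
    rw [twistHom_ι, twistHom_ι, hB, map_twistOp M.polynomial N.polynomial f.1 hp ha]
  | mul x y hx hy => simp only [map_mul, Module.End.mul_apply, hx, hy]
  | add x y hx hy => simp only [map_add, LinearMap.add_apply, hx, hy]

/-- Twisting along a reversal, as a functor. -/
def twistFunctor : EqMod.{u} (QuadAlg ε U) ⥤ EqMod.{u} (QuadAlg ε' U') where
  obj M := twist h b M
  map {M N} f := ⟨f.1, map_twistHom h b f, fun (m : M.carrier) => by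
    change f.1 (parity (degSign M.polynomial m)) = parity (degSign N.polynomial (f.1 m))
    rw [f.2.2.1, map_degSign M.polynomial N.polynomial f.1 f.2.2.2], f.2.2.2⟩
  map_id _ := rfl
  map_comp _ _ := rfl

instance : (twistFunctor.{u} h b).Additive where
  map_add := rfl

instance : (twistFunctor.{u} h b).Linear ℂ where
  map_smul _ _ := rfl

variable (M : EqMod.{u} (QuadAlg ε U))

theorem twist_twist_smul (x : QuadAlg ε U) (m : M.carrier) :
    twistHom h.symm (!b) (twist h b M) x m = x • m := by
  -- An algebra map is determined by its values on generators; abstracting it as `T` keeps the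
  -- twisted structures on the same carrier out of the induction.
  suffices H : ∀ T : QuadAlg ε U →ₐ[ℂ] Module.End ℂ M.carrier,
      (∀ u m, T (QuadAlg.ι u) m = (QuadAlg.ι u : QuadAlg ε U) • m) → ∀ m, T x m = x • m by
    refine H (twistHom h.symm (!b) (twist h b M)) (fun u m => ?_) m
    refine (twistHom_ι h.symm (!b) (twist h b M) u m).trans ?_
    change twistHom h b M (QuadAlg.ι (h.equiv.symm u)) (@twistOp M.carrier _ _
      (twistRep M.polynomial) (twistRep_isPolynomial M.polynomial) (!b) m) = _
    rw [twistRep_twistOp, twistHom_ι, twistOp_twistOp, h.equiv.apply_symm_apply]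
  intro T hT
  induction x using QuadAlg.induction with
  | scalar r =>
    intro m
    rw [AlgHom.commutes, Module.algebraMap_end_apply, algebraMap_smul]
  | gen u => exact hT u
  | mul x y hx hy =>
    intro m
    rw [map_mul, Module.End.mul_apply, hy, hx, mul_smul]
  | add x y hx hy =>
    intro m
    rw [map_add, LinearMap.add_apply, hx, hy, add_smul]

theorem twist_twist_parity (m : M.carrier) :
    (twist h.symm (!b) (twist h b M)).superRep.parity m = parity m := by
  change parity (degSign M.polynomial (@degSign M.carrier _ _
      (twistRep M.polynomial) (twistRep_isPolynomial M.polynomial) m)) = _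
  rw [twistRep_degSign, degSign_degSign]

/-- Twisting back recovers the module. -/
def twistTwistIso : twist h.symm (!b) (twist h b M) ≅ M where
  hom := ⟨(LinearMap.id : M.carrier →ₗ[ℂ] M.carrier), twist_twist_smul h b M,
    twist_twist_parity h b M, fun _ _ _ => rfl⟩
  inv := ⟨(LinearMap.id : M.carrier →ₗ[ℂ] M.carrier), fun x m => (twist_twist_smul h b M x m).symm,
    fun m => (twist_twist_parity h b M m).symm, fun _ _ _ => rfl⟩
  hom_inv_id := rfl
  inv_hom_id := rfl

/-- The equivalence of module categories given by a reversal. -/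
def twistEquivalence : EqMod.{u} (QuadAlg ε U) ≌ EqMod.{u} (QuadAlg ε' U') :=
  -- Opposite Boolean values make both composites the identity on carriers, so naturality is
  -- definitional.
  CategoryTheory.Equivalence.mk (twistFunctor h false) (twistFunctor h.symm true)
    (NatIso.ofComponents (fun M => (twistTwistIso h false M).symm) fun _ => rfl)
    (NatIso.ofComponents (fun M => twistTwistIso h.symm true M) fun _ => rfl)

end Functor

/-! ### Submodules -/

section Submodules

/-- The set `W` underlies a submodule in the category of polynomial representations. -/
def IsSubmoduleSet {B : Type} [Ring B] [Algebra ℂ B] [SuperRep B] (M : EqMod.{u} B)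
    (W : Set M.carrier) : Prop :=
  ∃ N : Submodule B M.carrier, M.IsSubmodule N ∧ (N : Set M.carrier) = W

/-- Submodules of a module and of its twist are over different rings; only their underlying sets can
be compared. -/
theorem isFG_iff {B : Type} [Ring B] [Algebra ℂ B] [SuperRep B] (M : EqMod.{u} B)
    (N : Submodule B M.carrier) : M.IsFG N ↔ ∃ s : Finset M.carrier, (s : Set M.carrier) ⊆ N ∧
      ∀ W, M.IsSubmoduleSet W → (s : Set M.carrier) ⊆ W → (N : Set M.carrier) ⊆ W := by
  refine exists_congr fun s => and_congr_right fun _ => ⟨?_, fun H N' hN' => H _ ⟨N', hN', rfl⟩⟩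
  rintro H _ ⟨N', hN', rfl⟩
  exact H N' hN'

variable (h : Reversal ε ε' U U') (b : Bool) (M : EqMod.{u} (QuadAlg ε U))

/-- The twisted generators and the twisted parity are built from the old generators, parity and
`degSign`, all of which preserve `W`. -/
theorem IsSubmoduleSet.twist {M : EqMod.{u} (QuadAlg ε U)} {W : Set M.carrier}
    (hW : M.IsSubmoduleSet W) : (twist h b M).IsSubmoduleSet W := by
  obtain ⟨N, ⟨hp, ha⟩, rfl⟩ := hW
  let N₀ : Submodule ℂ M.carrier := N.restrictScalars ℂ
  have key : ∀ (x : QuadAlg ε' U') (m : M.carrier), m ∈ N₀ → twistHom h b M x m ∈ N₀ := by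
    intro x
    induction x using QuadAlg.induction with
    | scalar r =>
      intro m hm
      rw [AlgHom.commutes, Module.algebraMap_end_apply]
      exact N₀.smul_mem r hm
    | gen u =>
      intro m hm
      rw [twistHom_ι]
      exact N.smul_mem _ (twistOp_mem M.polynomial (W := N₀) hp ha b hm)
    | mul x y hx hy =>
      intro m hm
      rw [map_mul]
      exact hx _ (hy _ hm)
    | add x y hx hy =>
      intro m hm
      rw [map_add]
      exact N₀.add_mem (hx _ hm) (hy _ hm)
  exact ⟨{ carrier := (N : Set M.carrier)
           add_mem' := N.add_mem
           zero_mem' := N.zero_mem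
           smul_mem' := key },
    ⟨fun m hm => hp _ (degSign_mem M.polynomial (W := N₀) ha hm), ha⟩, rfl⟩

/-- For the converse, twist once more and use that the double twist has the original multiplication
and parity. -/
theorem isSubmoduleSet_twist_iff (W : Set M.carrier) :
    (twist h b M).IsSubmoduleSet W ↔ M.IsSubmoduleSet W := by
  refine ⟨fun hW => ?_, fun hW => hW.twist h b⟩
  obtain ⟨N, ⟨hp, ha⟩, hN⟩ := hW.twist h.symm (!b)
  refine ⟨{ carrier := SetLike.coe N
            add_mem' := N.add_mem
            zero_mem' := N.zero_mem
            smul_mem' := fun x (m : M.carrier) hm => ?_ },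
    ⟨fun (m : M.carrier) hm => ?_, ha⟩, hN⟩
  · rw [← twist_twist_smul h b M x m]
    exact N.smul_mem x hm
  · rw [← twist_twist_parity h b M m]
    exact hp m hm

theorem isFG_twist_iff (N : Submodule (QuadAlg ε U) M.carrier)
    (N' : Submodule (QuadAlg ε' U') (twist h b M).carrier) (hN : SetLike.coe N' = (N : Set M.carrier)) :
    (twist h b M).IsFG N' ↔ M.IsFG N := by
  rw [isFG_iff, isFG_iff]
  refine exists_congr fun (s : Finset M.carrier) => ?_
  rw [hN]
  exact and_congr_right fun _ => forall_congr' fun (W : Set M.carrier) =>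
    imp_congr_left (isSubmoduleSet_twist_iff h b M W)

end Submodules

end EqMod

/-- Finite generation is transferred through equal underlying sets, with the same finite generating
set, rather than through the abstract equivalence. -/
theorem Reversal.isNoeth (h : Reversal ε ε' U U') (H : IsNoeth.{u} (QuadAlg ε' U')) :
    IsNoeth.{u} (QuadAlg ε U) := by
  intro M hM N hN
  obtain ⟨N', hN', e⟩ := EqMod.IsSubmoduleSet.twist h false ⟨N, hN, rfl⟩
  exact (EqMod.isFG_twist_iff h false M N N' e).1
    (H _ ((EqMod.isFG_twist_iff h false M ⊤ ⊤ rfl).2 hM) N' hN')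

/-! ### The two algebras -/

theorem QuadAlg.isDeg_mul {j k : ℕ} {x y : QuadAlg ε U} (hx : IsDeg j x) (hy : IsDeg k y) :
    IsDeg (j + k) (x * y) := by
  classical
  obtain ⟨S, hS⟩ := hx
  obtain ⟨S', hS'⟩ := hy
  refine ⟨S ∪ S', fun T hT => ?_⟩
  have h : euler _ T (x * y) = euler _ T x * y + x * euler _ T y := by
    simp_rw [euler_apply, SuperAlgebra.act_mul, add_self, parityPow_zero, Finset.sum_add_distrib,
      Finset.sum_mul, Finset.mul_sum]
  rw [h, hS T (Finset.union_subset_left hT), hS' T (Finset.union_subset_right hT), smul_mul_assoc,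
    mul_smul_comm, ← add_smul, Nat.cast_add]

theorem sym2_isDeg (x : Sym2) : IsDeg 2 x := by
  refine IsDeg.of_injective Sym2.subtype (fun _ _ _ => rfl) Subtype.val_injective ?_
  refine Submodule.span_induction (p := fun m _ => IsDeg 2 m) ?_ (IsDeg.zero 2)
    (fun _ _ _ _ => IsDeg.add) (fun r _ _ hx => hx.smul r) x.2
  rintro _ ⟨v, w, rfl⟩
  have hι : ∀ v : Vee, IsDeg 1 (QuadAlg.ι v : SymAlg Vee) := fun v =>
    (tpow_isDeg v).map QuadAlg.ι fun a b u => (QuadAlg.der_ι a b u).symm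
  exact QuadAlg.isDeg_mul (hι v) (hι w)

/-- The identity map as a reversal from `Sym²(𝕍)[1]` to `Sym²(𝕍)`. -/
def sym2Reversal : Reversal 1 (-1) (Shift 1 Sym2) Sym2 where
  sign_eq := rfl
  equiv := LinearEquiv.refl ℂ Sym2
  map_parity u := by
    change parity u = -((sgn 1 • parity : Module.End ℂ Sym2) u)
    simp
  map_act _ _ _ := rfl
  isDeg u := sym2_isDeg u

end SuperTCA

end

theorem proposition2p1 :
    (∃ F : SuperTCA.EqMod.{u} SuperTCA.A ≌ SuperTCA.EqMod.{u} SuperTCA.A',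
      F.functor.Additive ∧ F.functor.Linear ℂ) ∧
    (SuperTCA.IsNoeth.{u} SuperTCA.A ↔ SuperTCA.IsNoeth.{u} SuperTCA.A') :=
  ⟨⟨SuperTCA.EqMod.twistEquivalence SuperTCA.sym2Reversal,
    inferInstanceAs (SuperTCA.EqMod.twistFunctor SuperTCA.sym2Reversal false).Additive,
    inferInstanceAs ((SuperTCA.EqMod.twistFunctor SuperTCA.sym2Reversal false).Linear ℂ)⟩,
    SuperTCA.sym2Reversal.symm.isNoeth, SuperTCA.sym2Reversal.isNoeth⟩
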